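/- Let $\mathcal X,\mathcal Y,\widehat{\mathcal Y}$ be measurable spaces, where singletons of $\mathcal X$ and of $\mathcal Y$ are measurable, and assume that $|\mathcal X|=\infty$ or $|\mathcal Y|=\infty$. Let $\ell:\widehat{\mathcal Y}\times\mathcal Y\to[0,B]$ be a measurable loss. An \emph{algorithm} $\mathcal A$ maps a data set $\mathcal D\in\bigcup_{m\ge 0}(\mathcal X\times\mathcal Y)^m$ and a seed $\xi\in[0,1]$ to a model $\mathcal A(\mathcal D;\xi):\mathcal X\to\widehat{\mathcal Y}$, such that for each $m$ the map $(\mathcal D,\xi,x)\mapsto[\mathcal A(\mathcal D;\xi)](x)$ is measurable on $(\mathcal X\times\mathcal Y)^m\times[0,1]\times\mathcal X$. Fix $n,N\ge 1$, $\alpha\in(0,1)$, $\tau>0$ and $q\in\{1,2\}$. For a probability distribution $P$ on $\mathcal X\times\mathcal Y$, let $(X_i,Y_i)_{1\le i\le n+1}$ be i.i.d. from $P$ and $\xi\sim\mathrm{Unif}[0,1]$ independent of them, and put $\widehat f_n=\mathcal A\big((X_i,Y_i)_{i\le n};\xi\big)$ and $\widehat f_n^{-j}=\mathcal A\big((X_i,Y_i)_{i\le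 n,\,i\ne j};\xi\big)$. Define \[R_{P,n}(\mathcal A)=\mathbb E\big[\ell(\widehat f_n(X_{n+1}),Y_{n+1})\big],\qquad R_P^{\max}=\sup_{f:\mathcal X\to\widehat{\mathcal Y}\text{ measurable}}\mathbb E_{(X,Y)\sim P}\big[\ell(f(X),Y)\big],\] \[\beta_q(\mathcal A,P,n)=\max_{1\le j\le n}\mathbb E\Big[\big|\ell(\widehat f_n(X_{n+1}),Y_{n+1})-\ell(\widehat f_n^{-j}(X_{n+1}),Y_{n+1})\big|^q\Big]^{1/q}.\] A \emph{black-box test} $\widehat T$ takes an algorithm $\mathcal A$ and a data set $\mathcal D_N\in(\mathcal X\times\mathcal Y)^N$ and returns a randomized value $\widehat T(\mathcal A,\mathcal D_N)\in\{0,1\}$ as follows, with independent $\mathrm{Unif}[0,1]$ seeds $\zeta^{(1)},\zeta^{(2)},\dots,\zeta$. In round $r=1,2,\dots$ a data set $\mathcal D^{(r)}$ of any finite size and a seed $\xi^{(r)}$ are chosen by a fixed rule as a function of $\mathcal D_N$, $(\mathcal D^{(s)},\widehat f^{(s)},\zeta^{(s)},\xi^{(s)})_{s<r}$ and $\zeta^{(r)}$,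 and the model $\widehat f^{(r)}=\mathcal A(\mathcal D^{(r)};\xi^{(r)})$ is computed. The procedure stops after the first round $\widehat r\ge1$ at which a fixed stopping criterion holds, which depends on $\mathcal D_N$ and the rounds so far. The output is a fixed function of $\mathcal D_N$, $(\mathcal D^{(s)},\widehat f^{(s)},\zeta^{(s)},\xi^{(s)})_{s\le\widehat r}$ and $\zeta$. For every $\mathcal A$ the output is a measurable function of $\mathcal D_N$ and the seeds, and for every $\mathcal A$ and $P$ the number of rounds $\widehat r$ is almost surely finite when $\mathcal D_N$ is i.i.d. from $P$ and independent of the seeds. \textbf{Theorem.} Let $\gamma_q\ge 2B/n^{1/q}$, and let $\widehat T$ be a black-box test such that \[\mathbb P_P\big(\widehat T(\mathcal A,\mathcal D_N)=1\big)\le\alpha\quad\text{for all }\mathcal A,P\text{ with }\beta_q(\mathcal A,P,n)\le\gamma_q\text{ and }R_{P,n}(\mathcal A)\ge\tau,\] where $\mathbb P_P$ refers to $\mathcal D_N$ i.i.d. from $P$ and to the seeds of the test. Let $\tilde\tau=\tau\big(1+\frac{\alpha^{-1}-1}{N}\big)$. Then for all $\mathcal A$ and $P$ with $\beta_q(\mathcal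 A,P,n)\le\gamma_q$, $R_{P,n}(\mathcal A)<\tau$ and $\tilde\tau<R_P^{\max}$, \[\mathbb P_P\big(\widehat T(\mathcal A,\mathcal D_N)=1\big)\le\left[\alpha\left(1+\frac{\tilde\tau-R_{P,n}(\mathcal A)}{R_P^{\max}-\tilde\tau}\right)^{N/n}\right]\wedge 1.\] -/

import Mathlib

open MeasureTheory

namespace AlgorithmTesting

/-- A data set of arbitrary finite size (possibly zero) with points in `Z`, in a given order. -/
abbrev Dataset (Z : Type*) := Σ m : ℕ, (Fin m → Z)

/-- The data set `D` with its `j`-th point removed, the others keeping their order. -/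
def dropPoint {Z : Type*} {n : ℕ} (D : Fin n → Z) (j : Fin n) : Dataset Z :=
  ⟨n - 1, fun i =>
    if (i : ℕ) < j then D ⟨i, by omega⟩ else D ⟨i + 1, by omega⟩⟩

/-- A (possibly randomized) regression algorithm: it takes a data set of any size and a random
seed in `[0,1]` and returns a fitted model `X → Yhat`; the returned prediction is jointly
measurable in the data, the seed and the feature value. -/
structure Algorithm (X Y Yhat : Type*)
    [MeasurableSpace X] [MeasurableSpace Y] [MeasurableSpace Yhat] where
  /-- The fitted model returned on a data set and a seed. -/
  fit : Dataset (X × Y) → unitInterval → X → Yhat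
  /-- Joint measurability, for every sample size. -/
  measurable_fit : ∀ m : ℕ, Measurable
    (fun p : (Fin m → X × Y) × unitInterval × X => fit ⟨m, p.1⟩ p.2.1 p.2.2)

/-- The random seeds `ζ⁽¹⁾, ζ⁽²⁾, …` used in the successive rounds, together with the seed `ζ`
used for the final decision. -/
abbrev Seeds := (ℕ → unitInterval) × unitInterval

/-- All seeds are independent and uniformly distributed on `[0,1]`. -/
noncomputable def seedLaw : Measure Seeds :=
  (Measure.infinitePi (fun _ : ℕ => (volume : Measure unitInterval))).prod
    (volume : Measure unitInterval)

section Risk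

variable {X Y Yhat : Type*} [MeasurableSpace X] [MeasurableSpace Y] [MeasurableSpace Yhat]

/-- The joint law of `n` i.i.d. training points from `P`, an independent test point from `P`, and
an independent uniform random seed. -/
noncomputable def trainTestLaw (P : Measure (X × Y)) (n : ℕ) :
    Measure ((Fin n → X × Y) × (X × Y) × unitInterval) :=
  (Measure.pi (fun _ : Fin n => P)).prod (P.prod (volume : Measure unitInterval))

/-- The risk of a single model: `R_P(f) = E[ℓ(f(X), Y)]`. -/
noncomputable def modelRisk (loss : Yhat → Y → ℝ) (P : Measure (X × Y)) (f : X → Yhat) : ℝ :=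
  ∫ z, loss (f z.1) z.2 ∂P

/-- `R_P^max`, the supremum of the risk over all (measurable) models. -/
noncomputable def maxRisk (loss : Yhat → Y → ℝ) (P : Measure (X × Y)) : ℝ :=
  ⨆ f : {f : X → Yhat // Measurable f}, modelRisk loss P f.1

/-- The risk `R_{P,n}(A)` of an algorithm: the expected loss at a new test point of the model
fitted on `n` training points. -/
noncomputable def algRisk (loss : Yhat → Y → ℝ) (P : Measure (X × Y)) (n : ℕ)
    (A : Algorithm X Y Yhat) : ℝ :=
  ∫ ω, loss (A.fit ⟨n, ω.1⟩ ω.2.2 ω.2.1.1) ω.2.1.2 ∂(trainTestLaw P n)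

/-- The `ℓ_q`-stability `β_q(A,P,n)`: the largest over `j` of the `L^q` norm of the change in the
loss at a new test point when the `j`-th training point is dropped (with the same seed). -/
noncomputable def stability (loss : Yhat → Y → ℝ) (q : ℕ) (A : Algorithm X Y Yhat)
    (P : Measure (X × Y)) (n : ℕ) : ℝ :=
  ⨆ j : Fin n,
    (∫ ω, |loss (A.fit ⟨n, ω.1⟩ ω.2.2 ω.2.1.1) ω.2.1.2
        - loss (A.fit (dropPoint ω.1 j) ω.2.2 ω.2.1.1) ω.2.1.2| ^ q
      ∂(trainTestLaw P n)) ^ (1 / (q : ℝ))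

end Risk

/-- The record of one round of a black-box procedure: the data set `D⁽ʳ⁾` and the seed `ξ⁽ʳ⁾` on
which the algorithm was called, the fitted model it returned, and the seed `ζ⁽ʳ⁾` that the
procedure used in that round. -/
structure Round (X Y Yhat : Type*) where
  data : Dataset (X × Y)
  algSeed : unitInterval
  model : X → Yhat
  procSeed : unitInterval

/-- A black-box procedure for data sets of size `N`. The list argument is the record of all rounds
so far, in order; its length is the number of rounds so far, so the rules may depend on the round
number. The rules are arbitrary functions. -/
structure Procedure (X Y Yhat : Type*) (N : ℕ) where
  /-- The data set and seed on which to call the algorithm next. -/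
  query : (Fin N → X × Y) → List (Round X Y Yhat) → unitInterval → Dataset (X × Y) × unitInterval
  /-- The stopping criterion, inspected after each round. -/
  halt : (Fin N → X × Y) → List (Round X Y Yhat) → Prop
  /-- The decision, once the procedure has stopped. -/
  decision : (Fin N → X × Y) → List (Round X Y Yhat) → unitInterval → Fin 2

section BlackBox

variable {X Y Yhat : Type*} [MeasurableSpace X] [MeasurableSpace Y] [MeasurableSpace Yhat] {N : ℕ}

/-- The record of the first `r` rounds when the procedure is run on the algorithm `A` and the data
set `D`. -/
def Procedure.history (Q : Procedure X Y Yhat N) (A : Algorithm X Y Yhat) (D : Fin N → X × Y)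
    (ζ : ℕ → unitInterval) : ℕ → List (Round X Y Yhat)
  | 0 => []
  | r + 1 =>
    let h := Q.history A D ζ r
    let c := Q.query D h (ζ r)
    h ++ [{ data := c.1, algSeed := c.2, model := A.fit c.1 c.2, procSeed := ζ r }]

/-- The run stops after exactly `r ≥ 1` rounds: `r` is the first round after which the stopping
criterion holds. -/
def Procedure.StopsAt (Q : Procedure X Y Yhat N) (A : Algorithm X Y Yhat) (D : Fin N → X × Y)
    (ζ : ℕ → unitInterval) (r : ℕ) : Prop :=
  1 ≤ r ∧ Q.halt D (Q.history A D ζ r) ∧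
    ∀ s, 1 ≤ s → s < r → ¬ Q.halt D (Q.history A D ζ s)

/-- The joint law of the data set of `N` i.i.d. points from `P` and of the independent seeds. -/
noncomputable def runLaw (P : Measure (X × Y)) (N : ℕ) : Measure ((Fin N → X × Y) × Seeds) :=
  (Measure.pi (fun _ : Fin N => P)).prod seedLaw

/-- A randomized test `T` (with values in `{0,1}`) is a black-box test if its output is measurable
in the data and the seeds, for every algorithm, and it is the decision of a procedure which, for
every algorithm and every distribution of the data, stops after finitely many rounds with
probability one. Measurability is asked of the output only, not of the intermediate steps. -/
structure IsBlackBoxTest (T : Algorithm X Y Yhat → (Fin N → X × Y) → Seeds → Fin 2) : Prop where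
  measurable : ∀ A, Measurable (fun ω : (Fin N → X × Y) × Seeds => T A ω.1 ω.2)
  exists_procedure : ∃ Q : Procedure X Y Yhat N,
    (∀ (A : Algorithm X Y Yhat) (P : Measure (X × Y)), IsProbabilityMeasure P →
      ∀ᵐ ω ∂(runLaw P N), ∃ r, Q.StopsAt A ω.1 ω.2.1 r) ∧
    ∀ (A : Algorithm X Y Yhat) (D : Fin N → X × Y) (ζ : Seeds) (r : ℕ),
      Q.StopsAt A D ζ.1 r → T A D ζ = Q.decision D (Q.history A D ζ.1 r) ζ.2

/-- The probability that the test returns `1`, over the data and the randomization of the test. -/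
noncomputable def rejectProb (T : Algorithm X Y Yhat → (Fin N → X × Y) → Seeds → Fin 2)
    (A : Algorithm X Y Yhat) (P : Measure (X × Y)) : ℝ :=
  (runLaw P N).real {ω | T A ω.1 ω.2 = 1}

end BlackBox

end AlgorithmTesting

/-! The proof is by contradiction and pits the pair `(A, P)` against a nearby pair to which the
validity of the test applies. Pick a point `z` and a model `f` with risk close to the supremum `M`.
Replace `P` by `s P + (1 - s) δ_z`, and replace `A` by the algorithm that returns `f` as soon as its
data contain `z`. If `z` has negligible mass under `P`, a sample of size `n` misses `z` with
probability about `s ^ n`. The new risk is then at least about `s (s ^ n R + (1 - s ^ n) M)`, and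
`s` is tuned so that this exceeds `τ` (`le_algRisk_override`).

Stability survives: dropping point `j` can matter only if the sample misses `z`, where the old
algorithm is at work, or if `z` occurs at `j` alone, an event of probability about `(1 - s) s ^ (n -
1)`. The lower bound on `γ` pays for this (`integral_lossChange_override_le`,
`stability_budget_lt`). Hence the test rejects the new pair with probability at most `α`.

On the other hand, on samples of size `N` that avoid `z` the contaminated law is exactly `s ^ N`
times the original one (`pow_mul_runLaw_le_rejectProb`). A run that never queries a data set
containing `z` cannot distinguish the two algorithms. No single `z` need be negligible for both `P`
and the queries, so `z` runs along an injective sequence: a terminating run makes finitely many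
queries, each a finite data set, and so misses all but finitely many terms
(`eventually_override_eq`, `tendsto_runLaw_override`). In the limit `s ^ N * rejectProb T A P ≤ α`,
which is the claim. -/

namespace AlgorithmTesting

open Filter Topology Set

/-! ### Contaminated laws and samples that avoid a point. -/

section Contamination

variable {Z : Type*}

/-- The samples of size `m` that do not contain the point `z`. -/
def avoiding (m : ℕ) (z : Z) : Set (Fin m → Z) := {D | ∀ i, D i ≠ z}

theorem avoiding_eq_pi (m : ℕ) (z : Z) :
    avoiding m z = univ.pi (fun _ : Fin m => ({z}ᶜ : Set Z)) := by
  ext D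
  simp [avoiding]

/-- A fixed sample contains only finitely many terms of an injective sequence. -/
theorem eventually_mem_avoiding {z : ℕ → Z} (hz : Function.Injective z) {m : ℕ}
    (D : Fin m → Z) : ∀ᶠ k in atTop, D ∈ avoiding m (z k) := by
  simp only [avoiding, mem_ofPred_eq, eventually_all]
  intro i
  rw [← Nat.cofinite_eq_atTop]
  refine (Set.Subsingleton.finite (s := {k | D i = z k}) fun a ha b hb => ?_).compl_mem_cofinite
  simp only [mem_ofPred_eq] at ha hb
  exact hz (ha.symm.trans hb)

variable [MeasurableSpace Z]

/-- The law that keeps a draw from `P` with probability `s` and replaces it by `z` otherwise. -/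
noncomputable def contaminate (s : ℝ) (z : Z) (P : Measure Z) : Measure Z :=
  ENNReal.ofReal s • P + ENNReal.ofReal (1 - s) • Measure.dirac z

instance (s : ℝ) (z : Z) (P : Measure Z) [IsFiniteMeasure P] :
    IsFiniteMeasure (contaminate s z P) := by
  have h1 : IsFiniteMeasure (ENNReal.ofReal s • P) := P.smul_finite ENNReal.ofReal_ne_top
  have h2 : IsFiniteMeasure (ENNReal.ofReal (1 - s) • Measure.dirac z) :=
    (Measure.dirac z).smul_finite ENNReal.ofReal_ne_top
  unfold contaminate
  infer_instance

theorem isProbabilityMeasure_contaminate {s : ℝ} (h0 : 0 ≤ s) (h1 : s ≤ 1) (z : Z)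
    (P : Measure Z) [IsProbabilityMeasure P] : IsProbabilityMeasure (contaminate s z P) := by
  constructor
  simp [contaminate, ← ENNReal.ofReal_add h0 (sub_nonneg.2 h1)]

/-- The singletons are disjoint, so their masses are summable. This replaces the choice of a null
point, which may not exist when `P` is purely atomic. -/
theorem tendsto_measureReal_singleton [MeasurableSingletonClass Z] {z : ℕ → Z}
    (hz : Function.Injective z) (P : Measure Z) [IsFiniteMeasure P] :
    Tendsto (fun k => P.real {z k}) atTop (𝓝 0) := by
  have h : Tendsto (fun k => P {z k}) atTop (𝓝 0) := by
    apply ENNReal.tendsto_atTop_zero_of_tsum_ne_top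
    rw [← measure_iUnion _ (fun k => measurableSet_singleton _)]
    · exact measure_ne_top _ _
    · intro i j hij
      simpa [Function.onFun] using fun h => hij (hz h)
  simpa [measureReal_def, Function.comp_def] using (ENNReal.tendsto_toReal ENNReal.zero_ne_top).comp h

theorem integral_prod_contaminate {Ω Ω' : Type*} [MeasurableSpace Ω] [MeasurableSpace Ω']
    {s : ℝ} (h0 : 0 ≤ s) (h1 : s ≤ 1) (z : Z) (P : Measure Z) [IsFiniteMeasure P]
    (κ : Measure Ω) [IsFiniteMeasure κ] (ν : Measure Ω') [IsFiniteMeasure ν]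
    {g : Ω × Z × Ω' → ℝ} (hg : Measurable g) {C : ℝ} (hC : ∀ ω, |g ω| ≤ C) :
    ∫ ω, g ω ∂(κ.prod ((contaminate s z P).prod ν))
      = s * ∫ ω, g ω ∂(κ.prod (P.prod ν))
        + (1 - s) * ∫ ω, g ω ∂(κ.prod ((Measure.dirac z).prod ν)) := by
  have hint : ∀ μ : Measure (Ω × Z × Ω'), IsFiniteMeasure μ → Integrable g μ := fun μ _ =>
    Integrable.of_bound hg.aestronglyMeasurable C (ae_of_all _ hC)
  have h2 : SFinite (ENNReal.ofReal s • P) := inferInstance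
  have e : κ.prod ((contaminate s z P).prod ν) = ENNReal.ofReal s • κ.prod (P.prod ν)
      + ENNReal.ofReal (1 - s) • κ.prod ((Measure.dirac z).prod ν) := by
    simp only [contaminate, Measure.add_prod, Measure.prod_add, Measure.prod_smul_left,
      Measure.prod_smul_right]
  rw [e, integral_add_measure ((hint _ inferInstance).smul_measure ENNReal.ofReal_ne_top)
    ((hint _ inferInstance).smul_measure ENNReal.ofReal_ne_top)]
  simp [integral_smul_measure, ENNReal.toReal_ofReal h0, ENNReal.toReal_ofReal (sub_nonneg.2 h1)]

variable [MeasurableSingletonClass Z]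

theorem measurableSet_avoiding (m : ℕ) (z : Z) : MeasurableSet (avoiding m z) := by
  rw [avoiding_eq_pi]
  exact MeasurableSet.univ_pi fun _ => (measurableSet_singleton z).compl

theorem contaminate_restrict (s : ℝ) (z : Z) (P : Measure Z) :
    (contaminate s z P).restrict {z}ᶜ = ENNReal.ofReal s • P.restrict {z}ᶜ := by
  have h : (Measure.dirac z).restrict {z}ᶜ = 0 := by
    simp [Measure.restrict_eq_zero, Measure.dirac_apply' z (measurableSet_singleton z).compl]
  simp [contaminate, Measure.restrict_smul, Measure.restrict_add, h]

/-- Off `z` the Dirac part vanishes, so each coordinate contributes a factor `s`. The identity is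
exact even if `P` charges `z`, and it is the only change of measure in the proof. -/
theorem pi_contaminate_restrict_avoiding (m : ℕ) (s : ℝ) (z : Z) (P : Measure Z)
    [IsFiniteMeasure P] :
    (Measure.pi (fun _ : Fin m => contaminate s z P)).restrict (avoiding m z)
      = ENNReal.ofReal s ^ m • (Measure.pi (fun _ : Fin m => P)).restrict (avoiding m z) := by
  rw [avoiding_eq_pi, Measure.restrict_pi_pi, Measure.restrict_pi_pi]
  refine Measure.pi_eq fun t _ => ?_
  simp [contaminate_restrict, Measure.pi_pi, Finset.prod_mul_distrib]

theorem prod_pi_contaminate_restrict {Ω : Type*} [MeasurableSpace Ω] (m : ℕ) (s : ℝ) (z : Z)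
    (P : Measure Z) [IsFiniteMeasure P] (ν : Measure Ω) [SFinite ν] :
    ((Measure.pi (fun _ : Fin m => contaminate s z P)).prod ν).restrict (avoiding m z ×ˢ univ)
      = ENNReal.ofReal s ^ m •
        ((Measure.pi (fun _ : Fin m => P)).prod ν).restrict (avoiding m z ×ˢ univ) := by
  rw [← Measure.prod_restrict, ← Measure.prod_restrict, pi_contaminate_restrict_avoiding,
    Measure.prod_smul_left]

theorem setIntegral_prod_pi_contaminate {Ω : Type*} [MeasurableSpace Ω] (m : ℕ) {s : ℝ}
    (hs : 0 ≤ s) (z : Z) (P : Measure Z) [IsFiniteMeasure P] (ν : Measure Ω) [SFinite ν]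
    (g : (Fin m → Z) × Ω → ℝ) :
    ∫ ω in avoiding m z ×ˢ univ, g ω ∂((Measure.pi (fun _ => contaminate s z P)).prod ν)
      = s ^ m * ∫ ω in avoiding m z ×ˢ univ, g ω ∂((Measure.pi (fun _ => P)).prod ν) := by
  rw [prod_pi_contaminate_restrict, integral_smul_measure]
  simp [ENNReal.toReal_ofReal hs]

theorem pi_contaminate_real_avoiding_le (m : ℕ) {s : ℝ} (hs : 0 ≤ s) (z : Z) (P : Measure Z)
    [IsProbabilityMeasure P] :
    (Measure.pi (fun _ : Fin m => contaminate s z P)).real (avoiding m z) ≤ s ^ m := by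
  rw [← measureReal_restrict_apply_self, pi_contaminate_restrict_avoiding]
  simp only [measureReal_ennreal_smul_apply, ENNReal.toReal_pow, ENNReal.toReal_ofReal hs,
    measureReal_restrict_apply_self]
  exact mul_le_of_le_one_right (by positivity) measureReal_le_one

theorem contaminate_real_singleton {s : ℝ} (h0 : 0 ≤ s) (h1 : s ≤ 1) (z : Z) (P : Measure Z)
    [IsFiniteMeasure P] : (contaminate s z P).real {z} = s * P.real {z} + (1 - s) := by
  rw [contaminate, measureReal_add_apply (ENNReal.mul_ne_top ENNReal.ofReal_ne_top (measure_ne_top _ _))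
    (ENNReal.mul_ne_top ENNReal.ofReal_ne_top (measure_ne_top _ _))]
  simp [ENNReal.toReal_ofReal h0, ENNReal.toReal_ofReal (sub_nonneg.2 h1), measureReal_def]

/-- The probability that `z` is the `j`-th sample point and no other one. -/
theorem pi_contaminate_real_only_le {m : ℕ} {s : ℝ} (h0 : 0 ≤ s) (h1 : s ≤ 1) (z : Z)
    (P : Measure Z) [IsProbabilityMeasure P] (j : Fin m) :
    (Measure.pi (fun _ : Fin m => contaminate s z P)).real {D | D j = z ∧ ∀ i, i ≠ j → D i ≠ z}
      ≤ (s * P.real {z} + (1 - s)) * s ^ (m - 1) := by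
  classical
  have hset : {D : Fin m → Z | D j = z ∧ ∀ i, i ≠ j → D i ≠ z}
      = univ.pi (fun i => if i = j then {z} else {z}ᶜ) := by
    ext D
    simp only [mem_ofPred_eq, Set.mem_pi, mem_univ, forall_true_left]
    constructor
    · rintro ⟨hj, h⟩ i
      by_cases hi : i = j
      · simp [hi, hj]
      · simpa [hi] using h i hi
    · intro h
      exact ⟨by simpa using h j, fun i hi => by simpa [hi] using h i⟩
  have hc : (contaminate s z P).real {z}ᶜ ≤ s := by
    rw [← measureReal_restrict_apply_self, contaminate_restrict]
    simp only [measureReal_ennreal_smul_apply, ENNReal.toReal_ofReal h0]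
    exact mul_le_of_le_one_right h0
      ((measureReal_restrict_apply_self ..).le.trans measureReal_le_one)
  rw [hset, measureReal_def, Measure.pi_pi, ENNReal.toReal_prod,
    ← Finset.mul_prod_erase _ _ (Finset.mem_univ j)]
  simp only [if_true, ← measureReal_def, contaminate_real_singleton h0 h1]
  refine mul_le_mul_of_nonneg_left ?_ (by have := sub_nonneg.2 h1; positivity)
  calc ∏ i ∈ Finset.univ.erase j, (contaminate s z P).real (if i = j then {z} else {z}ᶜ)
      ≤ ∏ _i ∈ (Finset.univ : Finset (Fin m)).erase j, s := by
        refine Finset.prod_le_prod (fun _ _ => measureReal_nonneg) fun i hi => ?_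
        simpa [Finset.ne_of_mem_erase hi] using hc
    _ = s ^ (m - 1) := by simp

/-- Integrals over the samples that avoid the `k`-th term of an injective sequence converge to the
integral over all samples. -/
theorem tendsto_setIntegral_avoiding {Ω : Type*} [MeasurableSpace Ω] {z : ℕ → Z}
    (hz : Function.Injective z) (m : ℕ) {μ : Measure ((Fin m → Z) × Ω)}
    {g : (Fin m → Z) × Ω → ℝ} (hg : Integrable g μ) :
    Tendsto (fun k => ∫ ω in avoiding m (z k) ×ˢ univ, g ω ∂μ) atTop (𝓝 (∫ ω, g ω ∂μ)) := by
  simp_rw [← integral_indicator ((measurableSet_avoiding m (z _)).prod MeasurableSet.univ)]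
  refine tendsto_integral_of_dominated_convergence (fun ω => ‖g ω‖)
    (fun k => hg.aestronglyMeasurable.indicator
      ((measurableSet_avoiding m (z _)).prod MeasurableSet.univ)) hg.norm
    (fun k => ae_of_all _ fun ω => norm_indicator_le_norm_self _ _) (ae_of_all _ fun ω => ?_)
  -- For a fixed sample the indicator is eventually equal to one, so the integrand is eventually
  -- constant in `k`.
  refine tendsto_const_nhds.congr' ?_
  filter_upwards [eventually_mem_avoiding hz ω.1] with k hk
  rw [indicator_of_mem (by simpa using hk)]

end Contamination

/-! ### Overridden algorithms and their indistinguishability by black-box tests. -/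

section Override

variable {X Y Yhat : Type*} [MeasurableSpace X] [MeasurableSpace Y] [MeasurableSpace Yhat]
  [MeasurableSingletonClass X] [MeasurableSingletonClass Y] {N : ℕ}

open Classical in
/-- The algorithm that returns the model `f` on the data sets containing the point `z` and agrees
with `A` on all others. -/
noncomputable def Algorithm.override (A : Algorithm X Y Yhat) (f : X → Yhat) (hf : Measurable f)
    (z : X × Y) : Algorithm X Y Yhat where
  fit D ξ x := if D.2 ∈ avoiding D.1 z then A.fit D ξ x else f x
  measurable_fit m := Measurable.ite (measurable_fst (measurableSet_avoiding m z))
    (A.measurable_fit m) (hf.comp (measurable_snd.comp measurable_snd))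

variable (A : Algorithm X Y Yhat) {f : X → Yhat} (hf : Measurable f)

theorem Algorithm.override_fit_of_mem {z : X × Y} {D : Dataset (X × Y)}
    (h : D.2 ∈ avoiding D.1 z) (ξ : unitInterval) :
    (A.override f hf z).fit D ξ = A.fit D ξ := by
  funext x
  exact if_pos h

theorem Algorithm.override_fit_of_notMem {z : X × Y} {D : Dataset (X × Y)}
    (h : D.2 ∉ avoiding D.1 z) (ξ : unitInterval) :
    (A.override f hf z).fit D ξ = f := by
  funext x
  exact if_neg h

/-- Each new query depends only on the past record, and on a data set avoiding `z` the two
algorithms return the same model as a function. Only the queries of the run on `A` need to be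
controlled. -/
theorem Procedure.history_override (Q : Procedure X Y Yhat N) {z : X × Y} {D : Fin N → X × Y}
    {ζ : ℕ → unitInterval} {r : ℕ}
    (h : ∀ s < r, (Q.query D (Q.history A D ζ s) (ζ s)).1.2 ∈ avoiding _ z) :
    ∀ s ≤ r, Q.history (A.override f hf z) D ζ s = Q.history A D ζ s := by
  intro s
  induction s with
  | zero => intro _; rfl
  | succ s ih =>
    intro hs
    simp only [Procedure.history, ih (by omega),
      A.override_fit_of_mem hf (h s (by omega))]

/-- If a black-box test stops when run on `A`, then for a far enough term `z k` of an injective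
sequence of points, it cannot tell `A` from the algorithm overridden at `z k`. -/
theorem eventually_override_eq {T : Algorithm X Y Yhat → (Fin N → X × Y) → Seeds → Fin 2}
    {Q : Procedure X Y Yhat N}
    (hQ : ∀ (A : Algorithm X Y Yhat) (D : Fin N → X × Y) (ζ : Seeds) (r : ℕ),
      Q.StopsAt A D ζ.1 r → T A D ζ = Q.decision D (Q.history A D ζ.1 r) ζ.2)
    {z : ℕ → X × Y} (hz : Function.Injective z) {D : Fin N → X × Y} {ζ : Seeds} {r : ℕ}
    (hr : Q.StopsAt A D ζ.1 r) :
    ∀ᶠ k in atTop, T (A.override f hf (z k)) D ζ = T A D ζ := by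
  have h : ∀ᶠ k in atTop, ∀ s ∈ Finset.range r,
      (Q.query D (Q.history A D ζ.1 s) (ζ.1 s)).1.2 ∈ avoiding _ (z k) :=
    (Finset.eventually_all _).2 fun s _ => eventually_mem_avoiding hz _
  filter_upwards [h] with k hk
  have hist := Q.history_override A hf (fun s hs => hk s (Finset.mem_range.2 hs))
  have hrun : Q.StopsAt (A.override f hf (z k)) D ζ.1 r := by
    refine ⟨hr.1, ?_, fun s h1 h2 => ?_⟩
    · rw [hist r le_rfl]
      exact hr.2.1
    · rw [hist s h2.le]
      exact hr.2.2 s h1 h2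
  rw [hQ _ _ _ _ hrun, hQ _ _ _ _ hr, hist r le_rfl]

instance : IsProbabilityMeasure seedLaw := by
  unfold seedLaw
  infer_instance

instance (P : Measure (X × Y)) [IsProbabilityMeasure P] (m : ℕ) :
    IsProbabilityMeasure (trainTestLaw P m) := by
  unfold trainTestLaw
  infer_instance

instance (P : Measure (X × Y)) [IsProbabilityMeasure P] (m : ℕ) :
    IsProbabilityMeasure (runLaw P m) := by
  unfold runLaw
  infer_instance

/-- The limit is taken with the indicators of the output events, by dominated convergence. The event
that some query contains `z k` never enters, since it need not be measurable. -/
theorem tendsto_runLaw_override {T : Algorithm X Y Yhat → (Fin N → X × Y) → Seeds → Fin 2}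
    (hT : IsBlackBoxTest T) {z : ℕ → X × Y} (hz : Function.Injective z)
    (P : Measure (X × Y)) [IsProbabilityMeasure P] :
    Tendsto (fun k => (runLaw P N).real
        ({ω | T (A.override f hf (z k)) ω.1 ω.2 = 1} ∩ avoiding N (z k) ×ˢ univ))
      atTop (𝓝 (rejectProb T A P)) := by
  obtain ⟨Q, hrun, hQ⟩ := hT.exists_procedure
  have hmeas : ∀ A, MeasurableSet {ω : (Fin N → X × Y) × Seeds | T A ω.1 ω.2 = 1} := fun A =>
    hT.measurable A (measurableSet_singleton 1)
  have key : Tendsto (fun k => runLaw P N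
      ({ω | T (A.override f hf (z k)) ω.1 ω.2 = 1} ∩ avoiding N (z k) ×ˢ univ))
      atTop (𝓝 (runLaw P N {ω | T A ω.1 ω.2 = 1})) := by
    refine tendsto_measure_of_ae_tendsto_indicator_of_isFiniteMeasure atTop (hmeas A)
      (fun k => (hmeas _).inter ((measurableSet_avoiding N _).prod MeasurableSet.univ)) ?_
    filter_upwards [hrun A P inferInstance] with ω ⟨r, hr⟩
    filter_upwards [eventually_override_eq A hf hQ hz hr, eventually_mem_avoiding hz ω.1]
      with k h1 h2
    simp [h1, h2]
  exact (ENNReal.tendsto_toReal (measure_ne_top _ _)).comp key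

theorem pow_mul_runLaw_le_rejectProb
    (T : Algorithm X Y Yhat → (Fin N → X × Y) → Seeds → Fin 2)
    (P : Measure (X × Y)) [IsProbabilityMeasure P] {s : ℝ} (h0 : 0 ≤ s) (z : X × Y) :
    s ^ N * (runLaw P N).real ({ω | T A ω.1 ω.2 = 1} ∩ avoiding N z ×ˢ univ)
      ≤ rejectProb T A (contaminate s z P) := by
  have hm : MeasurableSet ((avoiding N z : Set (Fin N → X × Y)) ×ˢ (univ : Set Seeds)) :=
    (measurableSet_avoiding N z).prod MeasurableSet.univ
  have h := congrArg (fun μ : Measure ((Fin N → X × Y) × Seeds) =>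
    μ.real {ω | T A ω.1 ω.2 = 1}) (prod_pi_contaminate_restrict N s z P seedLaw)
  simp only [measureReal_restrict_apply' hm, measureReal_ennreal_smul_apply, ENNReal.toReal_pow,
    ENNReal.toReal_ofReal h0] at h
  rw [rejectProb, runLaw, runLaw, ← h]
  exact measureReal_mono inter_subset_left

end Override

/-! ### Risk and stability of the overridden algorithm under contamination. -/

theorem dropPoint_mem_avoiding_iff {Z : Type*} {n : ℕ} (D : Fin n → Z) (j : Fin n) (z : Z) :
    (dropPoint D j).2 ∈ avoiding (dropPoint D j).1 z ↔ ∀ i, i ≠ j → D i ≠ z := by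
  simp only [avoiding, dropPoint]
  constructor
  · intro h i hi
    rcases lt_or_gt_of_ne (fun e => hi (Fin.ext e) : (i : ℕ) ≠ j) with hlt | hgt
    · simpa [hlt] using h ⟨i, by omega⟩
    · have h' := h ⟨i - 1, by omega⟩
      have e : (i : ℕ) - 1 + 1 = i := by omega
      simpa [show ¬ ((i : ℕ) - 1 < j) by omega, e] using h'
  · intro h i
    dsimp only
    split_ifs with hi
    · exact h _ fun e => by simp [← e] at hi
    · exact h _ fun e => by simp [← e] at hi

section Bounds

variable {X Y Yhat : Type*} [MeasurableSpace X] [MeasurableSpace Y] [MeasurableSpace Yhat]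

/-- The loss, at a test point, of the model that `A` fits on the data set `D`. -/
def testLoss (loss : Yhat → Y → ℝ) (A : Algorithm X Y Yhat) (D : Dataset (X × Y))
    (w : (X × Y) × unitInterval) : ℝ :=
  loss (A.fit D w.2 w.1.1) w.1.2

/-- The absolute change of the loss, at a test point, when the `j`-th sample point is dropped. -/
def lossChange (loss : Yhat → Y → ℝ) (A : Algorithm X Y Yhat) {n : ℕ} (j : Fin n)
    (ω : (Fin n → X × Y) × (X × Y) × unitInterval) : ℝ :=
  |testLoss loss A ⟨n, ω.1⟩ ω.2 - testLoss loss A (dropPoint ω.1 j) ω.2|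

variable {loss : Yhat → Y → ℝ} (hloss : Measurable (Function.uncurry loss))
  {B : ℝ} (hB : ∀ yhat y, loss yhat y ∈ Icc 0 B)

include hloss in
theorem measurable_testLoss (A : Algorithm X Y Yhat) {Ω : Type*} [MeasurableSpace Ω] {m : ℕ}
    {d : Ω → Fin m → X × Y} (hd : Measurable d) {w : Ω → (X × Y) × unitInterval}
    (hw : Measurable w) : Measurable fun ω => testLoss loss A ⟨m, d ω⟩ (w ω) := by
  have h1 : Measurable fun ω => A.fit ⟨m, d ω⟩ (w ω).2 (w ω).1.1 :=
    (A.measurable_fit m).comp (hd.prodMk (hw.snd.prodMk hw.fst.fst))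
  exact hloss.comp (h1.prodMk hw.fst.snd)

include hloss in
theorem measurable_lossChange (A : Algorithm X Y Yhat) {n : ℕ} (j : Fin n) :
    Measurable (lossChange loss A j) := by
  have h1 := measurable_testLoss hloss A (Ω := (Fin n → X × Y) × (X × Y) × unitInterval)
    (d := fun ω => ω.1) measurable_fst (w := fun ω => ω.2) measurable_snd
  have h2 := measurable_testLoss hloss A (Ω := (Fin n → X × Y) × (X × Y) × unitInterval)
    (d := fun ω => (dropPoint ω.1 j).2)
    (by
      refine measurable_pi_lambda _ fun i => ?_
      simp only [dropPoint]
      split_ifs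
      · exact (measurable_pi_apply _).comp measurable_fst
      · exact (measurable_pi_apply _).comp measurable_fst)
    (w := fun ω => ω.2) measurable_snd
  exact (h1.sub h2).abs

include hB in
theorem abs_testLoss_le (A : Algorithm X Y Yhat) (D : Dataset (X × Y))
    (w : (X × Y) × unitInterval) : |testLoss loss A D w| ≤ B := by
  have := hB (A.fit D w.2 w.1.1) w.1.2
  rw [testLoss, abs_of_nonneg this.1]
  exact this.2

include hB in
theorem lossChange_le (A : Algorithm X Y Yhat) {n : ℕ} (j : Fin n)
    (ω : (Fin n → X × Y) × (X × Y) × unitInterval) : lossChange loss A j ω ≤ B := by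
  have h1 := hB (A.fit ⟨n, ω.1⟩ ω.2.2 ω.2.1.1) ω.2.1.2
  have h2 := hB (A.fit (dropPoint ω.1 j) ω.2.2 ω.2.1.1) ω.2.1.2
  rw [lossChange, testLoss, testLoss, abs_le]
  constructor <;> linarith [h1.1, h1.2, h2.1, h2.2]

theorem lossChange_nonneg (A : Algorithm X Y Yhat) {n : ℕ} (j : Fin n)
    (ω : (Fin n → X × Y) × (X × Y) × unitInterval) : 0 ≤ lossChange loss A j ω :=
  abs_nonneg _

variable [MeasurableSingletonClass X] [MeasurableSingletonClass Y]

include hloss hB in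
/-- The risk of the overridden algorithm under the contaminated distribution. -/
theorem le_algRisk_override (A : Algorithm X Y Yhat) {f : X → Yhat} (hf : Measurable f)
    (P : Measure (X × Y)) [IsProbabilityMeasure P] {s : ℝ} (h0 : 0 ≤ s) (h1 : s ≤ 1)
    (z : X × Y) (n : ℕ) :
    s * (s ^ n * (∫ ω in avoiding n z ×ˢ univ, testLoss loss A ⟨n, ω.1⟩ ω.2 ∂(trainTestLaw P n))
        + (1 - s ^ n) * modelRisk loss P f)
      ≤ algRisk loss (contaminate s z P) n (A.override f hf z) := by
  have := isProbabilityMeasure_contaminate h0 h1 z P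
  set κ : Measure (Fin n → X × Y) := Measure.pi (fun _ => contaminate s z P) with hκ
  set ν : Measure ((X × Y) × unitInterval) := P.prod volume with hν
  set g : (Fin n → X × Y) × (X × Y) × unitInterval → ℝ :=
    fun ω => testLoss loss (A.override f hf z) ⟨n, ω.1⟩ ω.2 with hgdef
  have hg : Measurable g := measurable_testLoss hloss _ measurable_fst measurable_snd
  have hgint : Integrable g (κ.prod ν) := Integrable.of_bound hg.aestronglyMeasurable B
    (ae_of_all _ fun ω => abs_testLoss_le hB _ _ _)
  have hSm : MeasurableSet ((avoiding n z : Set (Fin n → X × Y)) ×ˢ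
      (univ : Set ((X × Y) × unitInterval))) := (measurableSet_avoiding n z).prod .univ
  have e1 : algRisk loss (contaminate s z P) n (A.override f hf z)
      = s * ∫ ω, g ω ∂(κ.prod ν)
        + (1 - s) * ∫ ω, g ω ∂(κ.prod ((Measure.dirac z).prod volume)) :=
    integral_prod_contaminate h0 h1 z P κ volume hg fun ω => abs_testLoss_le hB _ _ _
  -- The loss at a contaminated test point is discarded. This costs the outer factor `s`, which is
  -- what forces the inflation of `τ` to `τ'`.
  have e2 : 0 ≤ ∫ ω, g ω ∂(κ.prod ((Measure.dirac z).prod volume)) :=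
    integral_nonneg fun ω => (hB _ _).1
  have e3 : ∫ ω in avoiding n z ×ˢ univ, g ω ∂(κ.prod ν)
      = s ^ n * ∫ ω in avoiding n z ×ˢ univ, testLoss loss A ⟨n, ω.1⟩ ω.2 ∂(trainTestLaw P n) := by
    rw [trainTestLaw, ← setIntegral_prod_pi_contaminate n h0 z P ν]
    refine setIntegral_congr_fun hSm fun ω hω => ?_
    simp only [hgdef, testLoss]
    rw [A.override_fit_of_mem hf (D := ⟨n, ω.1⟩) hω.1]
  have e4 : ∫ ω in (avoiding n z ×ˢ univ)ᶜ, g ω ∂(κ.prod ν)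
      = κ.real (avoiding n z)ᶜ * modelRisk loss P f := by
    have hc : ((avoiding n z : Set (Fin n → X × Y)) ×ˢ
        (univ : Set ((X × Y) × unitInterval)))ᶜ = (avoiding n z)ᶜ ×ˢ univ := by
      ext; simp
    have hfst : ∫ w, loss (f w.1.1) w.1.2 ∂ν = modelRisk loss P f := by
      rw [hν, integral_fun_fst (fun v : X × Y => loss (f v.1) v.2)]
      simp [modelRisk]
    rw [hc, setIntegral_congr_fun (g := fun ω => loss (f ω.2.1.1) ω.2.1.2)
      ((measurableSet_avoiding n z).compl.prod .univ), ← Measure.prod_restrict,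
      Measure.restrict_univ, integral_fun_snd (fun w : (X × Y) × unitInterval =>
        loss (f w.1.1) w.1.2), hfst, measureReal_restrict_apply_univ, smul_eq_mul]
    intro ω hω
    simp only [hgdef, testLoss]
    rw [A.override_fit_of_notMem hf (D := ⟨n, ω.1⟩) hω.1]
  -- Only an inequality, because `P` itself may charge `z`; since `f` has nonnegative risk, it goes
  -- in the useful direction.
  have e5 : 1 - s ^ n ≤ κ.real (avoiding n z)ᶜ := by
    rw [probReal_compl_eq_one_sub (measurableSet_avoiding n z)]
    linarith [pi_contaminate_real_avoiding_le n h0 z P]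
  have e6 : 0 ≤ modelRisk loss P f := integral_nonneg fun ω => (hB _ _).1
  rw [e1, ← integral_add_compl hSm hgint, e3, e4]
  have := mul_nonneg (sub_nonneg.2 h1) e2
  have := mul_le_mul_of_nonneg_left (mul_le_mul_of_nonneg_right e5 e6) h0
  linarith

include hloss hB in
/-- The `ℓ_q`-stability of the overridden algorithm under the contaminated distribution. -/
theorem integral_lossChange_override_le (A : Algorithm X Y Yhat) {f : X → Yhat}
    (hf : Measurable f) (P : Measure (X × Y)) [IsProbabilityMeasure P] {s : ℝ} (h0 : 0 ≤ s)
    (h1 : s ≤ 1) (z : X × Y) {n : ℕ} (j : Fin n) {q : ℕ} (hq : q ≠ 0) :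
    ∫ ω, lossChange loss (A.override f hf z) j ω ^ q ∂(trainTestLaw (contaminate s z P) n)
      ≤ s ^ n * (s * (∫ ω, lossChange loss A j ω ^ q ∂(trainTestLaw P n)) + (1 - s) * B ^ q)
        + (s * P.real {z} + (1 - s)) * s ^ (n - 1) * B ^ q := by
  have := isProbabilityMeasure_contaminate h0 h1 z P
  have hB0 : 0 ≤ B := by
    obtain ⟨x⟩ := P.nonempty_of_neZero
    exact (hB (f x.1) x.2).1.trans (hB (f x.1) x.2).2
  have hpow : ∀ (A : Algorithm X Y Yhat) ω, lossChange loss A j ω ^ q ≤ B ^ q := fun A ω =>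
    pow_le_pow_left₀ (lossChange_nonneg A j ω) (lossChange_le hB A j ω) q
  have hpow0 : ∀ (A : Algorithm X Y Yhat) ω, 0 ≤ lossChange loss A j ω ^ q := fun A ω =>
    pow_nonneg (lossChange_nonneg A j ω) q
  have habs : ∀ (A : Algorithm X Y Yhat) ω, |lossChange loss A j ω ^ q| ≤ B ^ q := fun A ω => by
    rw [abs_of_nonneg (hpow0 A ω)]
    exact hpow A ω
  have hint : ∀ (A : Algorithm X Y Yhat)
      (μ : Measure ((Fin n → X × Y) × (X × Y) × unitInterval)), IsFiniteMeasure μ →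
      Integrable (fun ω => lossChange loss A j ω ^ q) μ := fun A μ _ =>
    Integrable.of_bound ((measurable_lossChange hloss A j).pow_const q).aestronglyMeasurable
      (B ^ q) (ae_of_all _ (habs A))
  set κ : Measure (Fin n → X × Y) := Measure.pi (fun _ => contaminate s z P) with hκ
  set ν : Measure ((X × Y) × unitInterval) := (contaminate s z P).prod volume with hν
  have htrain : trainTestLaw (contaminate s z P) n = κ.prod ν := rfl
  have hSm : MeasurableSet ((avoiding n z : Set (Fin n → X × Y)) ×ˢ
      (univ : Set ((X × Y) × unitInterval))) := (measurableSet_avoiding n z).prod .univ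
  -- Here the override is inactive both before and after dropping a point. A test point drawn from
  -- the Dirac part is bounded crudely by `B ^ q`.
  have e1 : ∫ ω in avoiding n z ×ˢ univ, lossChange loss (A.override f hf z) j ω ^ q ∂(κ.prod ν)
      ≤ s ^ n * (s * (∫ ω, lossChange loss A j ω ^ q ∂(trainTestLaw P n)) + (1 - s) * B ^ q) := by
    have e : ∫ ω in avoiding n z ×ˢ univ, lossChange loss (A.override f hf z) j ω ^ q ∂(κ.prod ν)
        = ∫ ω in avoiding n z ×ˢ univ, lossChange loss A j ω ^ q ∂(κ.prod ν) := by
      refine setIntegral_congr_fun hSm fun ω hω => ?_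
      have hω' : (dropPoint ω.1 j).2 ∈ avoiding _ z :=
        (dropPoint_mem_avoiding_iff ω.1 j z).2 fun i _ => hω.1 i
      simp only [lossChange, testLoss]
      rw [A.override_fit_of_mem hf (D := ⟨n, ω.1⟩) hω.1, A.override_fit_of_mem hf hω']
    rw [e, hκ, setIntegral_prod_pi_contaminate n h0 z P ν]
    refine mul_le_mul_of_nonneg_left ?_ (by positivity)
    refine (setIntegral_le_integral (hint A _ inferInstance)
      (ae_of_all _ (hpow0 A))).trans ?_
    rw [hν, integral_prod_contaminate h0 h1 z P _ volume
      ((measurable_lossChange hloss A j).pow_const q) (habs A)]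
    refine add_le_add le_rfl (mul_le_mul_of_nonneg_left ?_ (sub_nonneg.2 h1))
    calc ∫ ω, lossChange loss A j ω ^ q ∂((Measure.pi fun _ => P).prod
          ((Measure.dirac z).prod volume))
        ≤ ∫ _ω, B ^ q ∂((Measure.pi fun _ : Fin n => P).prod
          ((Measure.dirac z).prod (volume : Measure unitInterval))) :=
          integral_mono (hint A _ inferInstance) (integrable_const _) (hpow A)
      _ = B ^ q := by simp
  -- If `z` survives the removal of point `j`, both fits equal `f` and the loss does not change.
  -- Only samples with `z` at `j` and nowhere else contribute.
  have e2 : ∫ ω in (avoiding n z ×ˢ univ)ᶜ,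
        lossChange loss (A.override f hf z) j ω ^ q ∂(κ.prod ν)
      ≤ (s * P.real {z} + (1 - s)) * s ^ (n - 1) * B ^ q := by
    set O : Set (Fin n → X × Y) := {D | D j = z ∧ ∀ i, i ≠ j → D i ≠ z} with hO
    have hOm : MeasurableSet O := by
      have : O = (fun D : Fin n → X × Y => D j) ⁻¹' {z} ∩
          ⋂ i, ⋂ (_ : i ≠ j), (fun D : Fin n → X × Y => D i) ⁻¹' {z}ᶜ := by
        ext; simp [hO]
      rw [this]
      exact (measurable_pi_apply j (measurableSet_singleton z)).inter
        (.iInter fun i => .iInter fun _ =>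
          measurable_pi_apply i (measurableSet_singleton z).compl)
    have hOU : MeasurableSet (O ×ˢ (univ : Set ((X × Y) × unitInterval))) := hOm.prod .univ
    have hi : Integrable ((O ×ˢ (univ : Set ((X × Y) × unitInterval))).indicator
        fun _ => B ^ q) (κ.prod ν) := (integrable_const _).indicator hOU
    calc _ ≤ ∫ ω in (avoiding n z ×ˢ univ)ᶜ,
            (O ×ˢ univ).indicator (fun _ => B ^ q) ω ∂(κ.prod ν) := by
          refine setIntegral_mono_on (hint _ _ inferInstance).integrableOn hi.integrableOn
            hSm.compl fun ω hω => ?_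
          by_cases hωO : ω.1 ∈ O
          · rw [indicator_of_mem (by simpa using hωO)]
            exact hpow _ _
          · have h3 : ω.1 ∉ avoiding n z := fun h => hω ⟨h, mem_univ _⟩
            have h4 : (dropPoint ω.1 j).2 ∉ avoiding _ z := by
              rw [dropPoint_mem_avoiding_iff]
              intro h
              refine hωO ⟨?_, h⟩
              by_contra hj
              exact h3 fun i => if hij : i = j then hij ▸ hj else h i hij
            rw [indicator_of_notMem (by simpa using hωO)]
            simp only [lossChange, testLoss]
            rw [A.override_fit_of_notMem hf (D := ⟨n, ω.1⟩) h3, A.override_fit_of_notMem hf h4]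
            simp [hq]
      _ ≤ ∫ ω, (O ×ˢ univ).indicator (fun _ => B ^ q) ω ∂(κ.prod ν) :=
          setIntegral_le_integral hi (ae_of_all _ fun ω =>
            indicator_nonneg (fun _ _ => by positivity) ω)
      _ = κ.real O * B ^ q := by
          rw [integral_indicator hOU, setIntegral_const, smul_eq_mul, measureReal_prod_prod]
          simp
      _ ≤ _ := mul_le_mul_of_nonneg_right (pi_contaminate_real_only_le h0 h1 z P j)
          (by positivity)
  rw [htrain, ← integral_add_compl hSm (hint _ _ inferInstance)]
  exact add_le_add e1 e2

end Bounds

theorem stability_le_iff {X Y Yhat : Type*} [MeasurableSpace X] [MeasurableSpace Y]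
    [MeasurableSpace Yhat] {loss : Yhat → Y → ℝ} {q n : ℕ} (hn : 1 ≤ n) (hq : q ≠ 0) {γ : ℝ}
    (hγ : 0 ≤ γ) {A : Algorithm X Y Yhat} {P : Measure (X × Y)} :
    stability loss q A P n ≤ γ ↔
      ∀ j : Fin n, ∫ ω, lossChange loss A j ω ^ q ∂(trainTestLaw P n) ≤ γ ^ q := by
  have : Nonempty (Fin n) := ⟨⟨0, hn⟩⟩
  have h0 : ∀ j : Fin n, 0 ≤ ∫ ω, lossChange loss A j ω ^ q ∂(trainTestLaw P n) := fun j =>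
    integral_nonneg fun ω => pow_nonneg (lossChange_nonneg A j ω) q
  have e : stability loss q A P n
      = ⨆ j : Fin n, (∫ ω, lossChange loss A j ω ^ q ∂(trainTestLaw P n)) ^ ((q : ℝ)⁻¹) := by
    simp only [stability, one_div]
    rfl
  rw [e, ciSup_le_iff (Set.finite_range _).bddAbove]
  refine forall_congr' fun j => ?_
  rw [Real.rpow_inv_le_iff_of_pos (h0 j) hγ (by positivity), Real.rpow_natCast]

/-- The terms in `b` add up to `(1 - s) s ^ (n - 1) (1 + s) b`. With `1 + s ≤ 2` and `2 b ≤ n G`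
this is at most `n (1 - s) s ^ (n - 1) G ≤ (1 - s ^ n) G`, while the term in `I` is below `s ^ n G`.
The strict inequality leaves room for the vanishing mass of `z k`. -/
theorem stability_budget_lt {n : ℕ} (hn : 1 ≤ n) {s I b G : ℝ} (hs0 : 0 < s) (hs1 : s < 1)
    (hG : 0 < G) (hI : I ≤ G) (hb : 2 * b ≤ n * G) :
    s ^ n * (s * I + (1 - s) * b) + (1 - s) * s ^ (n - 1) * b < G := by
  obtain ⟨m, rfl⟩ : ∃ m, n = m + 1 := ⟨n - 1, by omega⟩
  have hp : 0 < s ^ m := pow_pos hs0 m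
  -- Geometric sum: each of the `m + 1` terms is at least the last one, `s ^ m`.
  have hgeom : (1 - s) * ((m + 1 : ℕ) * s ^ m) ≤ 1 - s ^ (m + 1) := by
    rw [← mul_neg_geom_sum]
    refine mul_le_mul_of_nonneg_left ?_ (sub_nonneg.2 hs1.le)
    have := Finset.card_nsmul_le_sum (Finset.range (m + 1)) (fun i => s ^ i) (s ^ m) fun i hi =>
      pow_le_pow_of_le_one hs0.le hs1.le (Nat.lt_succ_iff.1 (Finset.mem_range.1 hi))
    simpa using this
  have h1 : s ^ (m + 1) * s * I ≤ s ^ (m + 1) * s * G :=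
    mul_le_mul_of_nonneg_left hI (by positivity)
  have h2 : (1 - s) * s ^ m * (1 + s) * (2 * b) ≤ (1 - s) * s ^ m * (1 + s) * ((m + 1 : ℕ) * G) :=
    mul_le_mul_of_nonneg_left hb (by have := sub_pos.2 hs1; positivity)
  have h3 : (1 - s) * s ^ m * ((m + 1 : ℕ) * G) * (1 + s)
      ≤ (1 - s) * s ^ m * ((m + 1 : ℕ) * G) * 2 :=
    mul_le_mul_of_nonneg_left (by linarith) (by have := sub_pos.2 hs1; positivity)
  have h4 := mul_le_mul_of_nonneg_right hgeom hG.le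
  have h5 : s ^ (m + 1) * s * G < s ^ (m + 1) * 1 * G := by gcongr
  have e : s ^ (m + 1) * (s * I + (1 - s) * b) + (1 - s) * s ^ (m + 1 - 1) * b
      = s ^ (m + 1) * s * I + (1 - s) * s ^ m * (1 + s) * b := by
    rw [Nat.add_sub_cancel]
    ring
  rw [e]
  linarith

end AlgorithmTesting

/-! ### The power bound: choice of parameters and passage to the limit. -/

theorem mainTheorem1 {X Y Yhat : Type*}
    [MeasurableSpace X] [MeasurableSpace Y] [MeasurableSpace Yhat]
    [MeasurableSingletonClass X] [MeasurableSingletonClass Y]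
    (hinf : Infinite X ∨ Infinite Y)
    (loss : Yhat → Y → ℝ) (hloss : Measurable (Function.uncurry loss))
    (B : ℝ) (hB : ∀ yhat y, loss yhat y ∈ Set.Icc 0 B)
    (n N : ℕ) (hn : 1 ≤ n) (hN : 1 ≤ N)
    (α : ℝ) (hα : α ∈ Set.Ioo (0 : ℝ) 1) (τ : ℝ) (hτ : 0 < τ)
    (q : ℕ) (hq : q = 1 ∨ q = 2)
    (γ : ℝ) (hγ : 2 * B / (n : ℝ) ^ (1 / (q : ℝ)) ≤ γ)
    (T : AlgorithmTesting.Algorithm X Y Yhat → (Fin N → X × Y) → AlgorithmTesting.Seeds → Fin 2)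
    (hT : AlgorithmTesting.IsBlackBoxTest T)
    (hvalid : ∀ (A : AlgorithmTesting.Algorithm X Y Yhat) (P : Measure (X × Y)),
      IsProbabilityMeasure P →
      AlgorithmTesting.stability loss q A P n ≤ γ →
      τ ≤ AlgorithmTesting.algRisk loss P n A →
      AlgorithmTesting.rejectProb T A P ≤ α)
    (τ' : ℝ) (hτ' : τ' = τ * (1 + (α⁻¹ - 1) / N))
    (A : AlgorithmTesting.Algorithm X Y Yhat) (P : Measure (X × Y)) [IsProbabilityMeasure P]
    (hstab : AlgorithmTesting.stability loss q A P n ≤ γ)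
    (hrisk : AlgorithmTesting.algRisk loss P n A < τ)
    (hmax : τ' < AlgorithmTesting.maxRisk loss P) :
    AlgorithmTesting.rejectProb T A P ≤
      min (α * (1 + (τ' - AlgorithmTesting.algRisk loss P n A) /
        (AlgorithmTesting.maxRisk loss P - τ')) ^ ((N : ℝ) / n)) 1 := by
  obtain ⟨hα0, hα1⟩ := hα
  set R := AlgorithmTesting.algRisk loss P n A with hR
  set M := AlgorithmTesting.maxRisk loss P with hM
  have hn0 : (0 : ℝ) < n := by exact_mod_cast hn
  have hN0 : (0 : ℝ) < N := by exact_mod_cast hN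
  have hq0 : q ≠ 0 := by omega
  have hprob : AlgorithmTesting.rejectProb T A P ≤ 1 := measureReal_le_one
  refine le_min ?_ hprob
  by_contra! hlt
  have hττ' : τ ≤ τ' := by
    have h1 : 1 ≤ α⁻¹ := (one_le_inv₀ hα0).2 hα1.le
    rw [hτ']
    exact le_mul_of_one_le_right hτ.le (by
      have := div_nonneg (sub_nonneg.2 h1) hN0.le
      linarith)
  have hMR : 0 < M - R := by linarith
  have hMτ : 0 < M - τ' := by linarith
  -- The weight solving `θ R + (1 - θ) M = τ'`. Its `n`-th root `s` makes `θ` the limiting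
  -- probability that a contaminated training sample avoids `z k`.
  set θ := (M - τ') / (M - R) with hθ
  have hθ0 : 0 < θ := div_pos hMτ hMR
  have hθ1 : θ < 1 := (div_lt_one hMR).2 (by linarith)
  set s := θ ^ ((n : ℝ)⁻¹) with hs
  have hs0 : 0 < s := Real.rpow_pos_of_pos hθ0 _
  have hs1 : s < 1 := Real.rpow_lt_one hθ0.le hθ1 (by positivity)
  have hsn : s ^ n = θ := Real.rpow_inv_natCast_pow hθ0.le (by omega)
  have hbound : α * (1 + (τ' - R) / (M - τ')) ^ ((N : ℝ) / n) = α / s ^ N := by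
    have e1 : 1 + (τ' - R) / (M - τ') = θ⁻¹ := by
      rw [hθ]
      field_simp
      ring
    rw [e1, Real.inv_rpow hθ0.le, div_eq_mul_inv α, hs, ← Real.rpow_natCast,
      ← Real.rpow_mul hθ0.le]
    congr 3
    field_simp
  rw [hbound] at hlt
  have hsN : α < s ^ N := (div_lt_one (by positivity)).1 (hlt.trans_le hprob)
  -- Bernoulli's inequality for `s⁻¹ ^ N`, combined with `s⁻¹ ^ N < α⁻¹`, gives `s⁻¹ < 1 + (α⁻¹ - 1)
  -- / N`. This is where the form of `τ'` comes from.
  have hsτ : τ / s < τ' := by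
    have h1 : 1 + (N : ℝ) * (s⁻¹ - 1) ≤ s⁻¹ ^ N := by
      have := one_add_mul_le_pow (a := s⁻¹ - 1) (by linarith [inv_pos.2 hs0]) N
      simpa using this
    have h2 : s⁻¹ ^ N < α⁻¹ := by
      rw [inv_pow]
      exact inv_strictAnti₀ hα0 hsN
    have h3 : s⁻¹ - 1 < (α⁻¹ - 1) / N := by
      rw [lt_div_iff₀ hN0]
      linarith
    rw [hτ', div_eq_mul_inv]
    exact mul_lt_mul_of_pos_left (by linarith) hτ
  obtain ⟨f, hf, hft, hf0⟩ : ∃ f : X → Yhat, Measurable f ∧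
      (τ / s - s ^ n * R) / (1 - s ^ n) < AlgorithmTesting.modelRisk loss P f ∧
      0 < AlgorithmTesting.modelRisk loss P f := by
    -- The fit of `A` on the empty data set is a measurable model.
    have hne : Nonempty {f : X → Yhat // Measurable f} :=
      ⟨⟨fun x => A.fit ⟨0, Fin.elim0⟩ 0 x, (A.measurable_fit 0).comp
        (measurable_const.prodMk (measurable_const.prodMk measurable_id))⟩⟩
    have h1 : (τ / s - s ^ n * R) / (1 - s ^ n) < M := by
      rw [div_lt_iff₀ (by linarith)]
      have : θ * (M - R) = M - τ' := div_mul_cancel₀ _ hMR.ne'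
      rw [hsn]
      nlinarith
    -- The maximum with `0` makes the risk of `f` positive, hence `B` and `γ` positive, as the
    -- strict stability budget requires.
    obtain ⟨f, hf⟩ := exists_lt_of_lt_ciSup (max_lt h1 (by linarith : (0 : ℝ) < M))
    exact ⟨f.1, f.2, (le_max_left _ _).trans_lt hf, (le_max_right _ _).trans_lt hf⟩
  rw [div_lt_iff₀ (by linarith)] at hft
  have hB0 : 0 < B := by
    refine hf0.trans_le ?_
    calc AlgorithmTesting.modelRisk loss P f ≤ ∫ _z, B ∂P :=
          integral_mono_of_nonneg (ae_of_all _ fun z => (hB _ _).1) (integrable_const _)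
            (ae_of_all _ fun z => (hB _ _).2)
      _ = B := by simp
  have hγ0 : 0 < γ := lt_of_lt_of_le (by positivity) hγ
  have hBγ : 2 * B ^ q ≤ n * γ ^ q := by
    have h1 : (2 * B) ^ q ≤ γ ^ q * n := by
      have h2 := pow_le_pow_left₀ (by positivity) hγ q
      rwa [div_pow, one_div, Real.rpow_inv_natCast_pow hn0.le hq0, div_le_iff₀ hn0] at h2
    have h2 : (2 : ℝ) ≤ 2 ^ q := le_self_pow₀ (by norm_num) hq0
    rw [mul_pow] at h1
    have := mul_le_mul_of_nonneg_right h2 (by positivity : 0 ≤ B ^ q)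
    linarith
  have : Nonempty (X × Y) := P.nonempty_of_neZero
  have : Nonempty X := ‹Nonempty (X × Y)›.map Prod.fst
  have : Nonempty Y := ‹Nonempty (X × Y)›.map Prod.snd
  have : Infinite (X × Y) := by
    rcases hinf with h | h
    · exact Prod.infinite_of_left
    · exact Prod.infinite_of_right
  let z : ℕ → X × Y := fun k => Infinite.natEmbedding (X × Y) k
  have hz : Function.Injective z := (Infinite.natEmbedding (X × Y)).injective
  have hEstab : ∀ᶠ k in Filter.atTop, AlgorithmTesting.stability loss q (A.override f hf (z k))
      (AlgorithmTesting.contaminate s (z k) P) n ≤ γ := by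
    simp_rw [AlgorithmTesting.stability_le_iff hn hq0 hγ0.le, Filter.eventually_all] at hstab ⊢
    intro j
    have hlim := ((((AlgorithmTesting.tendsto_measureReal_singleton hz P).const_mul s).add_const
      (1 - s)).mul_const (s ^ (n - 1))).mul_const (B ^ q) |>.const_add (s ^ n * (s *
        (∫ ω, AlgorithmTesting.lossChange loss A j ω ^ q ∂(AlgorithmTesting.trainTestLaw P n))
          + (1 - s) * B ^ q))
    filter_upwards [hlim.eventually_lt_const (u := γ ^ q) (by
      simpa using AlgorithmTesting.stability_budget_lt hn hs0 hs1 (by positivity) (hstab j) hBγ)]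
      with k hk
    exact (AlgorithmTesting.integral_lossChange_override_le hloss hB A hf P hs0.le hs1.le
      (z k) j hq0).trans hk.le
  have hErisk : ∀ᶠ k in Filter.atTop, τ ≤ AlgorithmTesting.algRisk loss
      (AlgorithmTesting.contaminate s (z k) P) n (A.override f hf (z k)) := by
    have hint : Integrable (fun ω : (Fin n → X × Y) × (X × Y) × unitInterval =>
        AlgorithmTesting.testLoss loss A ⟨n, ω.1⟩ ω.2) (AlgorithmTesting.trainTestLaw P n) :=
      Integrable.of_bound (AlgorithmTesting.measurable_testLoss hloss A measurable_fst
        measurable_snd).aestronglyMeasurable B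
        (ae_of_all _ fun ω => AlgorithmTesting.abs_testLoss_le hB _ _ _)
    have hlim := (((AlgorithmTesting.tendsto_setIntegral_avoiding hz n hint).const_mul
      (s ^ n)).add_const ((1 - s ^ n) * AlgorithmTesting.modelRisk loss P f)).const_mul s
    filter_upwards [hlim.eventually_const_lt (u := τ) (by
      -- The limiting integral is `R` by definition; the choice of `f` leaves a strict gap above
      -- `τ`.
      change τ < s * (s ^ n * R + _)
      rw [← div_lt_iff₀' hs0]
      linarith)] with k hk
    exact hk.le.trans (AlgorithmTesting.le_algRisk_override hloss hB A hf P hs0.le hs1.le (z k) n)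
  have hlim : s ^ N * AlgorithmTesting.rejectProb T A P ≤ α := by
    refine le_of_tendsto ((AlgorithmTesting.tendsto_runLaw_override A hf hT hz P).const_mul
      (s ^ N)) ?_
    filter_upwards [hEstab, hErisk] with k h1 h2
    exact (AlgorithmTesting.pow_mul_runLaw_le_rejectProb _ T P hs0.le (z k)).trans
      (hvalid _ _ (AlgorithmTesting.isProbabilityMeasure_contaminate hs0.le hs1.le (z k) P) h1 h2)
  rw [div_lt_iff₀' (by positivity)] at hlt
  linarith
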